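/- Let $\psi_k,\psi^*_k$ ($k\in\mathbb Z$) be the free fermion operators, $[\psi_k,\psi_l]_+=[\psi^*_k,\psi^*_l]_+=0$, $[\psi_k,\psi^*_l]_+=\delta_{kl}$, acting on the complex fermionic Fock space $\mathcal H_F$. This space has a basis of states $|I\rangle$ indexed by the sets $I\subset\mathbb Z$ of occupied modes that contain all sufficiently negative integers and no sufficiently large ones; $\psi_k$ fills the mode $k$ and $\psi^*_k$ empties it, up to the usual sign $(-1)^{\#\{i\in I:\ i>k\}}$, giving $0$ if this is impossible. The Dirac vacuum is $|0\rangle=|\{k<0\}\rangle$, and the charge operator is $Q=\sum_{k\ge 0}\psi_k\psi^*_k-\sum_{k<0}\psi^*_k\psi_k$, that is, $Q|I\rangle=c(I)|I\rangle$ with $c(I)=\#\{k\ge 0: k\in I\}-\#\{k<0: k\notin I\}$. Let $G$ be an operator given by arbitrary complex matrix elements $\langle I|G|J\rangle$ (it maps a finite combination of basis states to a possibly infinite formal combination; this includes all elements of the Clifford algebra generated by the $\psi_k,\psi^*_k$, and the infinite sums and products of them that have well-defined matrix elements). Suppose that $G$ satisfies the basic bilinear condition $$\sum_{k\in\mathbb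 Z}\psi_kG\otimes\psi^*_kG=\sum_{k\in\mathbb Z}G\psi_k\otimes G\psi^*_k ,$$ that is, $$\sum_{k\in\mathbb Z}\langle U|\psi_kG|V\rangle\,\langle U'|\psi^*_kG|V'\rangle=\sum_{k\in\mathbb Z}\langle U|G\psi_k|V\rangle\,\langle U'|G\psi^*_k|V'\rangle$$ for all finite combinations $|V\rangle,|V'\rangle$ of basis states and $\langle U|,\langle U'|$ of dual basis states (all these sums have only finitely many nonzero terms). Then $G$ has definite charge: there is an integer $q$ with $[Q,G]=qG$. Equivalently, if $G_q$ denotes the component of $G$ of charge $q$, with $\langle I|G_q|J\rangle=\langle I|G|J\rangle$ when $c(I)=c(J)+q$ and $0$ otherwise, then $G$ does not have two nonzero components $G_p$, $G_q$ with $p\neq q$. -/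

import Mathlib

noncomputable section

namespace FreeFermion

/-- The set of modes `I ⊆ ℤ` occupied in a basis state: it contains every sufficiently negative
integer and no sufficiently large one. The sets `I` with these two properties are exactly the
`I_{n,λ}`, for `n : ℤ` and `λ` a Young diagram. -/
@[ext]
structure Maya where
  modes : Set ℤ
  full_below : ∃ a : ℤ, ∀ k < a, k ∈ modes
  empty_above : ∃ b : ℤ, ∀ k, b ≤ k → k ∉ modes

namespace Maya

/-- `I ∪ {k}`. -/
def add (k : ℤ) (I : Maya) : Maya where
  modes := insert k I.modes
  full_below := by
    obtain ⟨a, ha⟩ := I.full_below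
    exact ⟨a, fun j hj => Or.inr (ha j hj)⟩
  empty_above := by
    obtain ⟨b, hb⟩ := I.empty_above
    refine ⟨max b (k + 1), fun j hj => ?_⟩
    have h1 : b ≤ j := le_trans (le_max_left _ _) hj
    have h2 : k + 1 ≤ j := le_trans (le_max_right _ _) hj
    rintro (h | h)
    · omega
    · exact hb j h1 h

/-- `I \ {k}`. -/
def remove (k : ℤ) (I : Maya) : Maya where
  modes := I.modes \ {k}
  full_below := by
    obtain ⟨a, ha⟩ := I.full_below
    refine ⟨min a k, fun j hj => ⟨ha j (lt_of_lt_of_le hj (min_le_left _ _)), ?_⟩⟩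
    have : j < k := lt_of_lt_of_le hj (min_le_right _ _)
    simp only [Set.mem_singleton_iff]
    omega
  empty_above := by
    obtain ⟨b, hb⟩ := I.empty_above
    exact ⟨b, fun j hj h => hb j hj h.1⟩

/-- The fermionic sign `(-1)^#{i ∈ I : i > k}`, picked up when the mode `k` is moved past the
occupied modes above it. -/
def sign (k : ℤ) (I : Maya) : ℂ := (-1) ^ {i : ℤ | i ∈ I.modes ∧ k < i}.ncard

/-- The charge of the basis state `I`: the number of occupied modes `k ≥ 0` minus the number of
unoccupied modes `k < 0`. -/
def charge (I : Maya) : ℤ :=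
  ({k : ℤ | 0 ≤ k ∧ k ∈ I.modes}.ncard : ℤ) - ({k : ℤ | k < 0 ∧ k ∉ I.modes}.ncard : ℤ)

end Maya

/-- The fermionic Fock space: finite linear combinations of basis states. -/
abbrev Fock : Type := Maya →₀ ℂ

/-- Formal states: arbitrary, possibly infinite, linear combinations of basis states. -/
abbrev FormalFock : Type := Maya → ℂ

/-- The basis state with occupied set `I`. For `I = {i₁ > i₂ > ⋯}` with `I ∩ {k < a} = {k < a}`
and `i₁, …, i_ℓ` the elements `≥ a` of `I`, it is `ψ_{i₁} ⋯ ψ_{i_ℓ} |a⟩`. -/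
def ket (I : Maya) : Fock := Finsupp.single I 1

open Classical in
/-- The operator `ψ_k` on the Fock space: it fills the mode `k`. -/
def psi (k : ℤ) : Fock →ₗ[ℂ] Fock :=
  Finsupp.linearCombination ℂ fun I : Maya =>
    if k ∈ I.modes then 0 else I.sign k • ket (I.add k)

open Classical in
/-- The operator `ψ*_k` on the Fock space: it empties the mode `k`. -/
def psiStar (k : ℤ) : Fock →ₗ[ℂ] Fock :=
  Finsupp.linearCombination ℂ fun I : Maya =>
    if k ∈ I.modes then I.sign k • ket (I.remove k) else 0

open Classical in
/-- The extension of `ψ_k` to formal states, by its matrix elements: the only basis state whose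
image under `ψ_k` involves `I` is `I \ {k}`, for `k ∈ I`. -/
def formalPsi (k : ℤ) : FormalFock →ₗ[ℂ] FormalFock where
  toFun f I := if k ∈ I.modes then I.sign k * f (I.remove k) else 0
  map_add' f g := by
    ext I
    by_cases h : k ∈ I.modes <;> simp [h, mul_add]
  map_smul' c f := by
    ext I
    by_cases h : k ∈ I.modes <;> simp [h, mul_left_comm]

open Classical in
/-- The extension of `ψ*_k` to formal states, by its matrix elements: the only basis state whose
image under `ψ*_k` involves `I` is `I ∪ {k}`, for `k ∉ I`. -/
def formalPsiStar (k : ℤ) : FormalFock →ₗ[ℂ] FormalFock where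
  toFun f I := if k ∈ I.modes then 0 else I.sign k * f (I.add k)
  map_add' f g := by
    ext I
    by_cases h : k ∈ I.modes <;> simp [h, mul_add]
  map_smul' c f := by
    ext I
    by_cases h : k ∈ I.modes <;> simp [h, mul_left_comm]

/-- The normally ordered product of `ψ_k` and `ψ*_k` with respect to the Dirac vacuum `|0⟩`: for
`k ≥ 0` it is `ψ_k ψ*_k`, for `k < 0` it is `-ψ*_k ψ_k`. -/
def normalPair (k : ℤ) : Fock →ₗ[ℂ] Fock :=
  if 0 ≤ k then psi k ∘ₗ psiStar k else -(psiStar k ∘ₗ psi k)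

/-- `normalPair` on formal states. -/
def formalNormalPair (k : ℤ) : FormalFock →ₗ[ℂ] FormalFock :=
  if 0 ≤ k then formalPsi k ∘ₗ formalPsiStar k else -(formalPsiStar k ∘ₗ formalPsi k)

/-- The charge operator `Q`, the sum over `k ∈ ℤ` of the normally ordered `ψ_k ψ*_k`. On each basis
state only finitely many terms are nonzero (`normalPair_ket_finite`). -/
def chargeOp : Fock →ₗ[ℂ] Fock :=
  Finsupp.linearCombination ℂ fun I : Maya => ∑ᶠ k : ℤ, normalPair k (ket I)

/-- The charge operator on formal states, coefficient by coefficient. In each coefficient only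
finitely many terms are nonzero (`formalNormalPair_finite`). -/
def formalChargeOp (f : FormalFock) : FormalFock :=
  fun I => ∑ᶠ k : ℤ, formalNormalPair k f I

/-- Elements of the (completed) Clifford algebra, as operators in the Fock space: they are given by
an arbitrary array of matrix elements between basis states. -/
abbrev Operator : Type := Fock →ₗ[ℂ] FormalFock

/-- The pairing `⟨U|f⟩` of a dual state, a finite combination `∑ U_I ⟨I|`, with a formal state. -/
def pairing (U : Fock) (f : FormalFock) : ℂ := U.sum fun I c => c * f I

/-- The basic bilinear condition `∑_k ψ_k G ⊗ ψ*_k G = ∑_k G ψ_k ⊗ G ψ*_k`, in matrix elements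
between arbitrary states. All the sums have finitely many nonzero terms (`bilinear_left_finite`,
`bilinear_right_finite`). -/
def BasicBilinearCondition (G : Operator) : Prop :=
  ∀ U U' V V' : Fock,
    ∑ᶠ k : ℤ, pairing U (formalPsi k (G V)) * pairing U' (formalPsiStar k (G V')) =
      ∑ᶠ k : ℤ, pairing U (G (psi k V)) * pairing U' (G (psiStar k V'))

/-- `G` has definite charge `q`: `[Q, G] = q G`. -/
def HasCharge (G : Operator) (q : ℤ) : Prop :=
  ∀ V : Fock, formalChargeOp (G V) - G (chargeOp V) = (q : ℂ) • G V

/-- The component of `G` of charge `q`: the part of `G` that raises the charge of states by `q`. -/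
def chargeComponent (q : ℤ) (G : Operator) : Operator :=
  Finsupp.linearCombination ℂ fun J : Maya => fun I : Maya =>
    if I.charge = J.charge + q then G (ket J) I else 0

/-! Consistency of the definitions -/

namespace Maya

theorem finite_above (I : Maya) (a : ℤ) : {i : ℤ | i ∈ I.modes ∧ a ≤ i}.Finite := by
  obtain ⟨b, hb⟩ := I.empty_above
  refine (Set.finite_Ico a b).subset fun i hi => ⟨hi.2, ?_⟩
  by_contra h
  exact hb i (not_lt.mp h) hi.1

theorem finite_below (I : Maya) (a : ℤ) : {i : ℤ | i ∉ I.modes ∧ i < a}.Finite := by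
  obtain ⟨b, hb⟩ := I.full_below
  refine (Set.finite_Ico b a).subset fun i hi => ⟨?_, hi.2⟩
  by_contra h
  exact hi.1 (hb i (not_le.mp h))

theorem sign_mul_self (k : ℤ) (I : Maya) : I.sign k * I.sign k = 1 := by
  rw [sign, ← mul_pow]; simp

theorem sign_add (k : ℤ) (I : Maya) : (I.add k).sign k = I.sign k := by
  have : {i : ℤ | i ∈ (I.add k).modes ∧ k < i} = {i : ℤ | i ∈ I.modes ∧ k < i} := by
    ext i; simp only [add, Set.mem_insert_iff, Set.mem_ofPred_eq]
    constructor
    · rintro ⟨h | h, h'⟩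
      · omega
      · exact ⟨h, h'⟩
    · rintro ⟨h, h'⟩; exact ⟨Or.inr h, h'⟩
  simp only [sign, this]

theorem sign_remove (k : ℤ) (I : Maya) : (I.remove k).sign k = I.sign k := by
  have : {i : ℤ | i ∈ (I.remove k).modes ∧ k < i} = {i : ℤ | i ∈ I.modes ∧ k < i} := by
    ext i; simp only [remove, Set.mem_sdiff, Set.mem_singleton_iff, Set.mem_ofPred_eq]
    constructor
    · rintro ⟨h, h'⟩; exact ⟨h.1, h'⟩
    · rintro ⟨h, h'⟩; exact ⟨⟨h, by omega⟩, h'⟩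
  simp only [sign, this]

theorem add_remove (k : ℤ) (I : Maya) (h : k ∈ I.modes) : (I.remove k).add k = I := by
  ext i; simp only [add, remove, Set.mem_insert_iff, Set.mem_sdiff, Set.mem_singleton_iff]
  by_cases hi : i = k <;> simp [hi, h]

theorem remove_add (k : ℤ) (I : Maya) (h : k ∉ I.modes) : (I.add k).remove k = I := by
  ext i; simp only [add, remove, Set.mem_insert_iff, Set.mem_sdiff, Set.mem_singleton_iff]
  by_cases hi : i = k <;> simp [hi, h]

end Maya

open Classical in
theorem psi_ket (k : ℤ) (I : Maya) :
    psi k (ket I) = if k ∈ I.modes then 0 else I.sign k • ket (I.add k) := by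
  simp [psi, ket]

open Classical in
theorem psiStar_ket (k : ℤ) (I : Maya) :
    psiStar k (ket I) = if k ∈ I.modes then I.sign k • ket (I.remove k) else 0 := by
  simp [psiStar, ket]

theorem Maya.mem_add (k : ℤ) (I : Maya) : k ∈ (I.add k).modes := Or.inl rfl

theorem Maya.not_mem_remove (k : ℤ) (I : Maya) : k ∉ (I.remove k).modes := fun h => h.2 rfl

theorem Maya.sign_add_of_ne (k l : ℤ) (I : Maya) (h : l ∉ I.modes) :
    (I.add l).sign k = (if k < l then -1 else 1) * I.sign k := by
  have hf : {i : ℤ | i ∈ I.modes ∧ k < i}.Finite := I.finite_above (k + 1)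
  by_cases hkl : k < l
  · have e : {i : ℤ | i ∈ (I.add l).modes ∧ k < i} = insert l {i : ℤ | i ∈ I.modes ∧ k < i} := by
      ext i
      simp only [Maya.add, Set.mem_insert_iff, Set.mem_ofPred_eq]
      by_cases hi : i = l <;> simp [hi, hkl]
    have hn : l ∉ {i : ℤ | i ∈ I.modes ∧ k < i} := fun h' => h h'.1
    rw [Maya.sign, e, Set.ncard_insert_of_notMem hn hf, pow_succ, Maya.sign]
    simp [hkl]
  · have e : {i : ℤ | i ∈ (I.add l).modes ∧ k < i} = {i : ℤ | i ∈ I.modes ∧ k < i} := by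
      ext i
      simp only [Maya.add, Set.mem_insert_iff, Set.mem_ofPred_eq]
      by_cases hi : i = l <;> simp [hi, hkl]
    rw [Maya.sign, e, Maya.sign]
    simp [hkl]

theorem Maya.sign_remove_of_mem (k l : ℤ) (I : Maya) (h : l ∈ I.modes) :
    (I.remove l).sign k = (if k < l then -1 else 1) * I.sign k := by
  have := Maya.sign_add_of_ne k l (I.remove l) (Maya.not_mem_remove l I)
  rw [Maya.add_remove l I h] at this
  rw [this]
  split_ifs <;> simp

theorem Maya.add_comm' (k l : ℤ) (I : Maya) : (I.add k).add l = (I.add l).add k := by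
  ext i
  simp only [Maya.add, Set.mem_insert_iff]
  tauto

theorem Maya.remove_comm' (k l : ℤ) (I : Maya) : (I.remove k).remove l = (I.remove l).remove k := by
  ext i
  simp only [Maya.remove, Set.mem_sdiff, Set.mem_singleton_iff]
  tauto

theorem Maya.add_remove_comm (k l : ℤ) (I : Maya) (h : k ≠ l) :
    (I.remove l).add k = (I.add k).remove l := by
  ext i
  simp only [Maya.remove, Maya.add, Set.mem_insert_iff, Set.mem_sdiff, Set.mem_singleton_iff]
  by_cases hi : i = k
  · subst hi; simp [h]
  · simp [hi]

/-- The anticommutation relations `[ψ_k, ψ_l]₊ = 0`. -/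
theorem psi_psi (k l : ℤ) : psi k ∘ₗ psi l + psi l ∘ₗ psi k = 0 := by
  refine Finsupp.lhom_ext' fun I => LinearMap.ext_ring ?_
  change psi k (psi l (ket I)) + psi l (psi k (ket I)) = 0
  by_cases hkl : k = l
  · subst hkl
    by_cases h : k ∈ I.modes <;> simp [psi_ket, h, Maya.mem_add]
  have m1 : k ∈ (I.add l).modes ↔ k ∈ I.modes := by simp [Maya.add, hkl]
  have m2 : l ∈ (I.add k).modes ↔ l ∈ I.modes := by simp [Maya.add, Ne.symm hkl]
  by_cases h : k ∈ I.modes <;> by_cases h' : l ∈ I.modes <;> simp [psi_ket, h, h', m1, m2]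
  rw [Maya.sign_add_of_ne k l I h', Maya.sign_add_of_ne l k I h, Maya.add_comm' l k, smul_smul,
    smul_smul, ← add_smul]
  rcases lt_or_gt_of_ne hkl with hlt | hlt <;> simp [hlt, not_lt.mpr hlt.le, mul_comm]

/-- The anticommutation relations `[ψ*_k, ψ*_l]₊ = 0`. -/
theorem psiStar_psiStar (k l : ℤ) : psiStar k ∘ₗ psiStar l + psiStar l ∘ₗ psiStar k = 0 := by
  refine Finsupp.lhom_ext' fun I => LinearMap.ext_ring ?_
  change psiStar k (psiStar l (ket I)) + psiStar l (psiStar k (ket I)) = 0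
  by_cases hkl : k = l
  · subst hkl
    by_cases h : k ∈ I.modes <;> simp [psiStar_ket, h, Maya.not_mem_remove]
  have m1 : k ∈ (I.remove l).modes ↔ k ∈ I.modes := by simp [Maya.remove, hkl]
  have m2 : l ∈ (I.remove k).modes ↔ l ∈ I.modes := by simp [Maya.remove, Ne.symm hkl]
  by_cases h : k ∈ I.modes <;> by_cases h' : l ∈ I.modes <;> simp [psiStar_ket, h, h', m1, m2]
  rw [Maya.sign_remove_of_mem k l I h', Maya.sign_remove_of_mem l k I h, Maya.remove_comm' l k,
    smul_smul, smul_smul, ← add_smul]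
  rcases lt_or_gt_of_ne hkl with hlt | hlt <;> simp [hlt, not_lt.mpr hlt.le, mul_comm]

/-- The anticommutation relations `[ψ_k, ψ*_l]₊ = δ_{kl}`. -/
theorem psi_psiStar (k l : ℤ) :
    psi k ∘ₗ psiStar l + psiStar l ∘ₗ psi k = if k = l then LinearMap.id else 0 := by
  refine Finsupp.lhom_ext' fun I => LinearMap.ext_ring ?_
  change psi k (psiStar l (ket I)) + psiStar l (psi k (ket I)) =
    (if k = l then LinearMap.id else (0 : Fock →ₗ[ℂ] Fock)) (ket I)
  by_cases hkl : k = l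
  · subst hkl
    by_cases h : k ∈ I.modes <;>
      simp [psi_ket, psiStar_ket, h, Maya.not_mem_remove, Maya.mem_add, Maya.sign_add,
        Maya.sign_remove, Maya.add_remove, Maya.remove_add, smul_smul, Maya.sign_mul_self]
  have m1 : k ∈ (I.remove l).modes ↔ k ∈ I.modes := by simp [Maya.remove, hkl]
  have m2 : l ∈ (I.add k).modes ↔ l ∈ I.modes := by simp [Maya.add, Ne.symm hkl]
  by_cases h : k ∈ I.modes <;> by_cases h' : l ∈ I.modes <;>
    simp [psi_ket, psiStar_ket, h, h', m1, m2, hkl]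
  rw [Maya.sign_remove_of_mem k l I h', Maya.sign_add_of_ne l k I h, Maya.add_remove_comm k l I hkl,
    smul_smul, smul_smul, ← add_smul]
  rcases lt_or_gt_of_ne hkl with hlt | hlt <;> simp [hlt, not_lt.mpr hlt.le, mul_comm]

open Classical in
/-- The eigenvalue of the normally ordered `ψ_k ψ*_k` on the basis state `I`. -/
def normalValue (k : ℤ) (I : Maya) : ℤ :=
  if 0 ≤ k then (if k ∈ I.modes then 1 else 0) else (if k ∈ I.modes then 0 else -1)

theorem normalPair_ket (k : ℤ) (I : Maya) :
    normalPair k (ket I) = (normalValue k I : ℂ) • ket I := by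
  unfold normalPair normalValue
  by_cases hk : 0 ≤ k <;> by_cases h : k ∈ I.modes <;>
    simp [hk, h, psi_ket, psiStar_ket, Maya.mem_add, Maya.not_mem_remove, Maya.sign_add,
      Maya.sign_remove, Maya.add_remove, Maya.remove_add, smul_smul, Maya.sign_mul_self]

theorem formalNormalPair_apply (k : ℤ) (f : FormalFock) (I : Maya) :
    formalNormalPair k f I = (normalValue k I : ℂ) * f I := by
  unfold formalNormalPair normalValue
  by_cases hk : 0 ≤ k <;> by_cases h : k ∈ I.modes <;>
    simp [hk, h, formalPsi, formalPsiStar, Maya.mem_add, Maya.not_mem_remove, Maya.sign_add,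
      Maya.sign_remove, Maya.add_remove, Maya.remove_add, ← mul_assoc, Maya.sign_mul_self]

theorem normalValue_finite (I : Maya) : (Function.support fun k => normalValue k I).Finite := by
  refine ((I.finite_above 0).union (I.finite_below 0)).subset fun k hk => ?_
  simp only [Function.mem_support, normalValue] at hk
  by_cases h0 : 0 ≤ k <;> by_cases h : k ∈ I.modes <;> simp [h0, h] at hk ⊢
  omega

theorem normalValue_sum (I : Maya) : ∑ᶠ k : ℤ, normalValue k I = I.charge := by
  have h1 := I.finite_above 0
  have h2 := I.finite_below 0
  have e : (fun k => normalValue k I) = fun k =>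
      Set.indicator {k : ℤ | 0 ≤ k ∧ k ∈ I.modes} (fun _ => (1 : ℤ)) k -
        Set.indicator {k : ℤ | k < 0 ∧ k ∉ I.modes} (fun _ => (1 : ℤ)) k := by
    ext k
    by_cases h0 : 0 ≤ k <;> by_cases h : k ∈ I.modes <;>
      simp [normalValue, Set.indicator, h0, h]
  have f1 : {k : ℤ | 0 ≤ k ∧ k ∈ I.modes}.Finite := h1.subset fun k hk => ⟨hk.2, hk.1⟩
  have f2 : {k : ℤ | k < 0 ∧ k ∉ I.modes}.Finite := h2.subset fun k hk => ⟨hk.2, hk.1⟩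
  rw [e, finsum_sub_distrib (f1.subset (by simp)) (f2.subset (by simp)),
    ← finsum_mem_def, ← finsum_mem_def, finsum_mem_eq_finite_toFinset_sum _ f1,
    finsum_mem_eq_finite_toFinset_sum _ f2]
  simp [Maya.charge, Set.ncard_eq_toFinset_card _ f1, Set.ncard_eq_toFinset_card _ f2]

/-- `Q` multiplies a basis state by its charge. -/
theorem chargeOp_ket (I : Maya) : chargeOp (ket I) = (I.charge : ℂ) • ket I := by
  have h : chargeOp (ket I) = ∑ᶠ k : ℤ, normalPair k (ket I) := by simp [chargeOp, ket]
  rw [h]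
  simp only [normalPair_ket]
  have f : (Function.support fun k => ((normalValue k I : ℤ) : ℂ)).Finite :=
    (normalValue_finite I).subset fun k hk hz => hk (by simp only at hz; simp [hz])
  rw [← finsum_smul' f, ← normalValue_sum]
  congr 1
  exact ((Int.castAddHom ℂ).map_finsum (normalValue_finite I)).symm

/-- `Q` multiplies the coefficient at each basis state by the charge of that state. -/
theorem formalChargeOp_apply (f : FormalFock) (I : Maya) :
    formalChargeOp f I = (I.charge : ℂ) * f I := by
  unfold formalChargeOp
  simp only [formalNormalPair_apply]
  have h : (Function.support fun k => ((normalValue k I : ℤ) : ℂ)).Finite :=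
    (normalValue_finite I).subset fun k hk hz => hk (by simp only at hz; simp [hz])
  rw [← finsum_mul' _ _ h, ← normalValue_sum]
  congr 1
  exact ((Int.castAddHom ℂ).map_finsum (normalValue_finite I)).symm

theorem normalPair_ket_finite (I : Maya) :
    (Function.support fun k => normalPair k (ket I)).Finite := by
  refine (normalValue_finite I).subset fun k hk hz => hk ?_
  simp only [normalPair_ket]
  simp only at hz
  simp [hz]

theorem formalNormalPair_finite (f : FormalFock) (I : Maya) :
    (Function.support fun k => formalNormalPair k f I).Finite := by
  refine (normalValue_finite I).subset fun k hk hz => hk ?_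
  simp only [formalNormalPair_apply]
  simp only at hz
  simp [hz]

theorem formalPsi_coe (k : ℤ) (V : Fock) : formalPsi k V = psi k V := by
  induction V using Finsupp.induction_linear with
  | zero => ext I; simp
  | add V W hV hW => rw [Finsupp.coe_add, map_add, hV, hW, map_add, Finsupp.coe_add]
  | single J c =>
    classical
    ext I
    simp only [formalPsi, psi, LinearMap.coe_mk, AddHom.coe_mk, Finsupp.linearCombination_single]
    by_cases hI : k ∈ I.modes <;> by_cases hJ : k ∈ J.modes
    · have : J ≠ I.remove k := by rintro rfl; exact Maya.not_mem_remove k I hJ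
      simp [hI, hJ, this]
    · by_cases h : J = I.remove k
      · subst h
        simp [hI, hJ, ket, Maya.add_remove, Maya.sign_remove, mul_comm]
      · have h' : J.add k ≠ I := by
          rintro rfl; exact h (Maya.remove_add k J hJ).symm
        simp [hI, hJ, ket, h, h']
    · simp [hI, hJ]
    · have h' : J.add k ≠ I := by rintro rfl; exact hI (Maya.mem_add k J)
      simp [hI, hJ, ket, h']

theorem formalPsiStar_coe (k : ℤ) (V : Fock) : formalPsiStar k V = psiStar k V := by
  induction V using Finsupp.induction_linear with
  | zero => ext I; simp
  | add V W hV hW => rw [Finsupp.coe_add, map_add, hV, hW, map_add, Finsupp.coe_add]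
  | single J c =>
    classical
    ext I
    simp only [formalPsiStar, psiStar, LinearMap.coe_mk, AddHom.coe_mk,
      Finsupp.linearCombination_single]
    by_cases hI : k ∈ I.modes <;> by_cases hJ : k ∈ J.modes
    · have h' : J.remove k ≠ I := by rintro rfl; exact Maya.not_mem_remove k J hI
      simp [hI, hJ, ket, h']
    · simp [hI, hJ]
    · by_cases h : J = I.add k
      · subst h
        simp [hI, hJ, ket, Maya.remove_add, Maya.sign_add, mul_comm]
      · have h' : J.remove k ≠ I := by
          rintro rfl; exact h (Maya.add_remove k J hJ).symm
        simp [hI, hJ, ket, h, h']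
    · have : J ≠ I.add k := by rintro rfl; exact hJ (Maya.mem_add k I)
      simp [hI, hJ, this]

theorem psi_eq_zero_of_lt (V : Fock) : ∃ a : ℤ, ∀ k < a, psi k V = 0 := by
  induction V using Finsupp.induction_linear with
  | zero => exact ⟨0, fun k _ => map_zero _⟩
  | add V W hV hW =>
    obtain ⟨a, ha⟩ := hV
    obtain ⟨b, hb⟩ := hW
    exact ⟨min a b, fun k hk => by
      rw [map_add, ha k (lt_of_lt_of_le hk (min_le_left _ _)),
        hb k (lt_of_lt_of_le hk (min_le_right _ _)), add_zero]⟩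
  | single J c =>
    obtain ⟨a, ha⟩ := J.full_below
    exact ⟨a, fun k hk => by simp [psi, ha k hk]⟩

theorem psiStar_eq_zero_of_le (V : Fock) : ∃ b : ℤ, ∀ k, b ≤ k → psiStar k V = 0 := by
  induction V using Finsupp.induction_linear with
  | zero => exact ⟨0, fun k _ => map_zero _⟩
  | add V W hV hW =>
    obtain ⟨a, ha⟩ := hV
    obtain ⟨b, hb⟩ := hW
    exact ⟨max a b, fun k hk => by
      rw [map_add, ha k (le_trans (le_max_left _ _) hk),
        hb k (le_trans (le_max_right _ _) hk), add_zero]⟩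
  | single J c =>
    obtain ⟨b, hb⟩ := J.empty_above
    exact ⟨b, fun k hk => by simp [psiStar, hb k hk]⟩

theorem pairing_formalPsi_eq_zero (U : Fock) :
    ∃ b : ℤ, ∀ k, b ≤ k → ∀ f, pairing U (formalPsi k f) = 0 := by
  induction U using Finsupp.induction_linear with
  | zero => exact ⟨0, fun k _ f => by simp [pairing]⟩
  | add V W hV hW =>
    obtain ⟨a, ha⟩ := hV
    obtain ⟨b, hb⟩ := hW
    refine ⟨max a b, fun k hk f => ?_⟩
    have h1 := ha k (le_trans (le_max_left _ _) hk) f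
    have h2 := hb k (le_trans (le_max_right _ _) hk) f
    unfold pairing at h1 h2 ⊢
    rw [Finsupp.sum_add_index' (by simp) (by intros; ring), h1, h2, add_zero]
  | single J c =>
    obtain ⟨b, hb⟩ := J.empty_above
    exact ⟨b, fun k hk f => by simp [pairing, formalPsi, hb k hk]⟩

theorem pairing_formalPsiStar_eq_zero (U : Fock) :
    ∃ a : ℤ, ∀ k < a, ∀ f, pairing U (formalPsiStar k f) = 0 := by
  induction U using Finsupp.induction_linear with
  | zero => exact ⟨0, fun k _ f => by simp [pairing]⟩
  | add V W hV hW =>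
    obtain ⟨a, ha⟩ := hV
    obtain ⟨b, hb⟩ := hW
    refine ⟨min a b, fun k hk f => ?_⟩
    have h1 := ha k (lt_of_lt_of_le hk (min_le_left _ _)) f
    have h2 := hb k (lt_of_lt_of_le hk (min_le_right _ _)) f
    unfold pairing at h1 h2 ⊢
    rw [Finsupp.sum_add_index' (by simp) (by intros; ring), h1, h2, add_zero]
  | single J c =>
    obtain ⟨a, ha⟩ := J.full_below
    exact ⟨a, fun k hk f => by simp [pairing, formalPsiStar, ha k hk]⟩

theorem bilinear_left_finite (G : Operator) (U U' V V' : Fock) :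
    (Function.support fun k : ℤ =>
      pairing U (formalPsi k (G V)) * pairing U' (formalPsiStar k (G V'))).Finite := by
  obtain ⟨b, hb⟩ := pairing_formalPsi_eq_zero U
  obtain ⟨a, ha⟩ := pairing_formalPsiStar_eq_zero U'
  refine (Set.finite_Ico a b).subset fun k hk => ?_
  by_contra h
  apply hk
  rcases lt_or_ge k a with h1 | h1
  · simp [ha k h1]
  · simp [hb k (not_lt.mp fun h2 => h ⟨h1, h2⟩)]

theorem bilinear_right_finite (G : Operator) (U U' V V' : Fock) :
    (Function.support fun k : ℤ =>
      pairing U (G (psi k V)) * pairing U' (G (psiStar k V'))).Finite := by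
  obtain ⟨a, ha⟩ := psi_eq_zero_of_lt V
  obtain ⟨b, hb⟩ := psiStar_eq_zero_of_le V'
  refine (Set.finite_Ico a b).subset fun k hk => ?_
  by_contra h
  apply hk
  rcases lt_or_ge k a with h1 | h1
  · simp [ha k h1, pairing]
  · simp [hb k (not_lt.mp fun h2 => h ⟨h1, h2⟩), pairing]

end FreeFermion

end

/-!
Write `g(I, J) = ⟨I|G|J⟩` and call `c(I) - c(J)` the degree of the matrix element `g(I, J)`. The
claim is that all nonzero matrix elements have the same degree.

Between basis states, the bilinear condition is a system of Plücker relations for `g`: in the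
doubled set of modes, with a pair `(I, J)` encoded as the set `A = I ⊔ Jᶜ`, it reads
`∑_{k ∈ S \ T} ± g(S \ k) g(T ∪ k) = 0` for all `S`, `T`. Suppose `g(A) ≠ 0 ≠ g(B)` with the degree
of `A` smaller than that of `B`. Then there is a mode `m ∈ B \ A`, and in the relation for
`S = A ∪ m`, `T = B \ m` the term `k = m` is `± g(A) g(B) ≠ 0`. The other terms are indexed by
`k ∈ A \ B` and contain the factor `g(A ∪ m \ k)`; the set `A ∪ m \ k` has the degree of `A`, but is
closer to `B`. By induction on the (finite) cardinality of `A \ B` all these factors vanish, which is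
a contradiction. This is `matrixElement_eq_zero_of_lt`.

The doubled set is not introduced below: `m ∈ B \ A` means `m ∈ K \ I` or `m ∈ J \ L`, where
`B = K ⊔ Lᶜ`, and `#(A \ B)` is `#(I \ K) + #(L \ J)`.
-/

namespace FreeFermion

/-! ### Charge of basis states -/

namespace Maya

theorem charge_add (m : ℤ) (I : Maya) (h : m ∉ I.modes) : (I.add m).charge = I.charge + 1 := by
  have e : (fun k => normalValue k (I.add m)) =
      fun k => normalValue k I + if k = m then 1 else 0 := by
    ext k
    by_cases hk : k = m
    · subst hk
      by_cases h0 : 0 ≤ k <;> simp [normalValue, h0, h, mem_add]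
    · have : k ∈ (I.add m).modes ↔ k ∈ I.modes := by simp [add, hk]
      by_cases h0 : 0 ≤ k <;> by_cases hI : k ∈ I.modes <;> simp [normalValue, this, h0, hI, hk]
  have f : (Function.support fun k : ℤ => if k = m then (1 : ℤ) else 0).Finite :=
    (Set.finite_singleton m).subset fun k hk => by by_contra hne; simp_all
  rw [← normalValue_sum, e, finsum_add_distrib (normalValue_finite I) f, normalValue_sum,
    finsum_eq_single _ m fun k hk => by simp [hk]]
  simp

theorem charge_remove (m : ℤ) (I : Maya) (h : m ∈ I.modes) :
    (I.remove m).charge = I.charge - 1 := by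
  have := charge_add m (I.remove m) (not_mem_remove m I)
  rw [add_remove m I h] at this
  omega

theorem charge_mono {I J : Maya} (h : I.modes ⊆ J.modes) : I.charge ≤ J.charge := by
  rw [← sub_nonneg, ← normalValue_sum, ← normalValue_sum,
    ← finsum_sub_distrib (normalValue_finite J) (normalValue_finite I)]
  refine finsum_nonneg fun k => sub_nonneg.mpr ?_
  by_cases hI : k ∈ I.modes
  · simp [normalValue, hI, h hI]
  · by_cases h0 : 0 ≤ k <;> by_cases hJ : k ∈ J.modes <;> simp [normalValue, h0, hI, hJ]

theorem finite_diff (I J : Maya) : (I.modes \ J.modes).Finite := by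
  obtain ⟨a, ha⟩ := J.full_below
  exact (I.finite_above a).subset fun k hk => ⟨hk.1, not_lt.mp fun hlt => hk.2 (ha k hlt)⟩

theorem sign_ne_zero (k : ℤ) (I : Maya) : I.sign k ≠ 0 :=
  left_ne_zero_of_mul_eq_one (sign_mul_self k I)

/-- `(I', J')` is closer to `(K, L)` than `(I, J)` if the modes in which it exceeds `(K, L)`, where
unoccupied modes of the second entry are counted, form a proper subset of those for `(I, J)`. -/
theorem ncard_diff_add_lt {I I' J J' K L : Maya}
    (h₁ : I'.modes \ K.modes ⊆ I.modes \ K.modes) (h₂ : L.modes \ J'.modes ⊆ L.modes \ J.modes)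
    (h : (∃ k ∈ I.modes \ K.modes, k ∉ I'.modes) ∨ ∃ k ∈ L.modes \ J.modes, k ∈ J'.modes) :
    (I'.modes \ K.modes).ncard + (L.modes \ J'.modes).ncard <
      (I.modes \ K.modes).ncard + (L.modes \ J.modes).ncard := by
  rcases h with ⟨k, hk, hk'⟩ | ⟨k, hk, hk'⟩
  · exact add_lt_add_of_lt_of_le
      (Set.ncard_lt_ncard ⟨h₁, fun hs => hk' (hs hk).1⟩ (finite_diff _ _))
      (Set.ncard_le_ncard h₂ (finite_diff _ _))
  · exact add_lt_add_of_le_of_lt (Set.ncard_le_ncard h₁ (finite_diff _ _))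
      (Set.ncard_lt_ncard ⟨h₂, fun hs => (hs hk).2 hk'⟩ (finite_diff _ _))

end Maya

/-! ### The bilinear condition between basis states -/

theorem pairing_ket (I : Maya) (f : FormalFock) : pairing (ket I) f = f I := by
  simp [pairing, ket]

open Classical in
/-- The bilinear condition as a family of Plücker relations between matrix elements. -/
theorem BasicBilinearCondition.matrixElements {G : Operator} (hG : BasicBilinearCondition G)
    (U U' V V' : Maya) :
    ∑ᶠ k : ℤ, (if k ∈ U.modes ∧ k ∉ U'.modes then U.sign k * U'.sign k *
        (G (ket V) (U.remove k) * G (ket V') (U'.add k)) else 0) =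
      ∑ᶠ k : ℤ, (if k ∉ V.modes ∧ k ∈ V'.modes then V.sign k * V'.sign k *
        (G (ket (V.add k)) U * G (ket (V'.remove k)) U') else 0) := by
  convert hG (ket U) (ket U') (ket V) (ket V')
    using 3 with k k
  · rw [pairing_ket, pairing_ket]
    by_cases h : k ∈ U.modes <;> by_cases h' : k ∈ U'.modes <;>
      simp [formalPsi, formalPsiStar, h, h']
    ring
  · rw [pairing_ket, pairing_ket]
    by_cases h : k ∈ V.modes <;> by_cases h' : k ∈ V'.modes <;>
      simp [psi_ket, psiStar_ket, h, h']
    ring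

/-! ### Homogeneity of the matrix elements -/

/-- If some matrix element `⟨K|G|L⟩` is nonzero, then all matrix elements of smaller degree
vanish. The induction is on `#(I \ K) + #(L \ J)`; the relation used has `± ⟨I|G|J⟩ ⟨K|G|L⟩` as its
`m`-th term, and every other term vanishes by the induction hypothesis. -/
theorem BasicBilinearCondition.matrixElement_eq_zero_of_lt {G : Operator}
    (hG : BasicBilinearCondition G) {K L : Maya} (hKL : G (ket L) K ≠ 0) (I J : Maya)
    (hlt : I.charge - J.charge < K.charge - L.charge) : G (ket J) I = 0 := by
  classical
  induction hn : (I.modes \ K.modes).ncard + (L.modes \ J.modes).ncard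
    using Nat.strong_induction_on generalizing I J with
  | _ n ih =>
  subst hn
  have ih' : ∀ I' J' : Maya, I'.charge - J'.charge = I.charge - J.charge →
      I'.modes \ K.modes ⊆ I.modes \ K.modes → L.modes \ J'.modes ⊆ L.modes \ J.modes →
      ((∃ k ∈ I.modes \ K.modes, k ∉ I'.modes) ∨ ∃ k ∈ L.modes \ J.modes, k ∈ J'.modes) →
      G (ket J') I' = 0 := fun I' J' hc h₁ h₂ h =>
    ih _ (Maya.ncard_diff_add_lt h₁ h₂ h) I' J' (hc ▸ hlt) rfl
  -- A mode of `(K, L)` missing from `(I, J)`; it exists because the charges differ.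
  have hm : (∃ m ∈ K.modes, m ∉ I.modes) ∨ ∃ m ∈ J.modes, m ∉ L.modes := by
    by_contra! h
    have h₁ := Maya.charge_mono (I := K) (J := I) h.1
    have h₂ := Maya.charge_mono (I := J) (J := L) h.2
    omega
  rcases hm with ⟨m, hmK, hmI⟩ | ⟨m, hmJ, hmL⟩
  · have key := hG.matrixElements (I.add m) (K.remove m) J L
    have hI := Maya.charge_add m I hmI
    rw [finsum_eq_single _ m ?_, finsum_eq_zero_of_forall_eq_zero ?_] at key
    · simpa [Maya.mem_add, Maya.not_mem_remove, Maya.remove_add m I hmI, Maya.add_remove m K hmK,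
        Maya.sign_ne_zero, hKL] using key
    · intro k
      split_ifs with hk
      · have hJ := Maya.charge_add k J hk.1
        rw [ih' (I.add m) (J.add k) (by omega) ?_ ?_ (Or.inr ⟨k, ⟨hk.2, hk.1⟩, Maya.mem_add k J⟩)]
        · simp
        · rintro i ⟨rfl | hi, hi'⟩
          exacts [absurd hmK hi', ⟨hi, hi'⟩]
        · exact fun i hi => ⟨hi.1, fun h => hi.2 (Or.inr h)⟩
      · rfl
    · intro k hkm
      split_ifs with hk
      · have hkI : k ∈ I.modes := hk.1.resolve_left hkm
        have hkK : k ∉ K.modes := fun h => hk.2 ⟨h, hkm⟩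
        have hR := Maya.charge_remove k (I.add m) hk.1
        rw [ih' ((I.add m).remove k) J (by omega) ?_ subset_rfl
          (Or.inl ⟨k, ⟨hkI, hkK⟩, Maya.not_mem_remove k _⟩)]
        · simp
        · rintro i ⟨⟨rfl | hi, -⟩, hi'⟩
          exacts [absurd hmK hi', ⟨hi, hi'⟩]
      · rfl
  · have key := hG.matrixElements I K (J.remove m) (L.add m)
    have hJ := Maya.charge_remove m J hmJ
    rw [finsum_eq_zero_of_forall_eq_zero ?_, finsum_eq_single _ m ?_] at key
    · simpa [Maya.mem_add, Maya.not_mem_remove, Maya.remove_add m L hmL, Maya.add_remove m J hmJ,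
        Maya.sign_ne_zero, hKL] using key.symm
    · intro k hkm
      split_ifs with hk
      · have hkJ : k ∉ J.modes := fun h => hk.1 ⟨h, hkm⟩
        have hkL : k ∈ L.modes := hk.2.resolve_left hkm
        have hA := Maya.charge_add k (J.remove m) hk.1
        rw [ih' I ((J.remove m).add k) (by omega) subset_rfl ?_
          (Or.inr ⟨k, ⟨hkL, hkJ⟩, Maya.mem_add k _⟩)]
        · simp
        · exact fun i hi => ⟨hi.1, fun h => hi.2 (Or.inr ⟨h, fun e => hmL (e ▸ hi.1)⟩)⟩
      · rfl
    · intro k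
      split_ifs with hk
      · have hI := Maya.charge_remove k I hk.1
        rw [ih' (I.remove k) (J.remove m) (by omega) (fun i hi => ⟨hi.1.1, hi.2⟩) ?_
          (Or.inl ⟨k, hk, Maya.not_mem_remove k I⟩)]
        · simp
        · exact fun i hi => ⟨hi.1, fun h => hi.2 ⟨h, fun e => hmL (e ▸ hi.1)⟩⟩
      · rfl

theorem BasicBilinearCondition.charge_sub_charge_eq {G : Operator} (hG : BasicBilinearCondition G)
    {I J K L : Maya} (hIJ : G (ket J) I ≠ 0) (hKL : G (ket L) K ≠ 0) :
    I.charge - J.charge = K.charge - L.charge :=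
  le_antisymm (not_lt.mp fun h => hKL (hG.matrixElement_eq_zero_of_lt hIJ K L h))
    (not_lt.mp fun h => hIJ (hG.matrixElement_eq_zero_of_lt hKL I J h))

/-! ### Charge of an operator -/

theorem hasCharge_of_matrixElement {G : Operator} {q : ℤ}
    (h : ∀ I J : Maya, G (ket J) I ≠ 0 → I.charge - J.charge = q) : HasCharge G q := by
  intro V
  ext I
  simp only [Pi.sub_apply, Pi.smul_apply, smul_eq_mul, formalChargeOp_apply]
  induction V using Finsupp.induction_linear with
  | zero => simp
  | add V W hV hW =>
    simp only [map_add, Pi.add_apply]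
    linear_combination hV + hW
  | single J c =>
    have e : Finsupp.single J c = c • ket J := by simp [ket]
    rw [e, map_smul, map_smul, map_smul, chargeOp_ket, map_smul]
    simp only [Pi.smul_apply, smul_eq_mul]
    by_cases hIJ : G (ket J) I = 0
    · simp [hIJ]
    · rw [← h I J hIJ]
      push_cast
      ring

theorem exists_matrixElement_of_chargeComponent_ne_zero {G : Operator} {q : ℤ}
    (h : chargeComponent q G ≠ 0) :
    ∃ I J : Maya, G (ket J) I ≠ 0 ∧ I.charge - J.charge = q := by
  by_contra! hc
  refine h (Finsupp.lhom_ext' fun J => LinearMap.ext_ring ?_)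
  ext I
  have hIJ := hc I J
  simp only [chargeComponent, LinearMap.comp_apply, Finsupp.lsingle_apply,
    Finsupp.linearCombination_single, one_smul, LinearMap.zero_apply, Pi.zero_apply]
  split_ifs with hI
  · by_contra hne
    exact hIJ hne (by omega)
  · rfl

end FreeFermion

theorem mainTheorem6 (G : FreeFermion.Operator) (hG : FreeFermion.BasicBilinearCondition G) :
    (∃ q : ℤ, FreeFermion.HasCharge G q) ∧
      ∀ p q : ℤ, FreeFermion.chargeComponent p G ≠ 0 → FreeFermion.chargeComponent q G ≠ 0 →
        p = q := by
  refine ⟨?_, fun p q hp hq => ?_⟩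
  · by_cases h : ∃ K L : FreeFermion.Maya, G (FreeFermion.ket L) K ≠ 0
    · obtain ⟨K, L, hKL⟩ := h
      exact ⟨K.charge - L.charge, FreeFermion.hasCharge_of_matrixElement fun I J hIJ =>
        hG.charge_sub_charge_eq hIJ hKL⟩
    · -- Here `G = 0`, which has every charge.
      push Not at h
      exact ⟨0, FreeFermion.hasCharge_of_matrixElement fun I J hIJ => absurd (h I J) hIJ⟩
  · obtain ⟨I, J, hIJ, rfl⟩ := FreeFermion.exists_matrixElement_of_chargeComponent_ne_zero hp
    obtain ⟨K, L, hKL, rfl⟩ := FreeFermion.exists_matrixElement_of_chargeComponent_ne_zero hq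
    exact hG.charge_sub_charge_eq hIJ hKL
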